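/- Theorem (Hamkins). Every group has a terminating transfinite automorphism tower. In detail: for a group $H$, the natural map $H\to\operatorname{Aut}(H)$ sends $g\in H$ to the inner automorphism $h\mapsto ghg^{-1}$. An automorphism tower of a group $G$ is a family of groups $G_\alpha$, indexed by the ordinals, with a commuting system of homomorphisms $\pi_{\alpha,\beta}:G_\alpha\to G_\beta$ for $\alpha\le\beta$ ($\pi_{\alpha,\alpha}$ being the identity), such that, up to isomorphism, $G_0=G$; for every ordinal $\alpha$, $G_{\alpha+1}=\operatorname{Aut}(G_\alpha)$ and $\pi_{\alpha,\alpha+1}$ is the natural map; and for every limit ordinal $\lambda$, $G_\lambda$ is the direct limit of the groups $G_\alpha$, $\alpha<\lambda$, along the maps $\pi_{\alpha,\beta}$, with the $\pi_{\alpha,\lambda}$ as its canonical maps. The tower terminates if there is an ordinal $\gamma$ such that the natural map $G_\gamma\to\operatorname{Aut}(G_\gamma)$ is an isomorphism. Then every group $G$ has an automorphism tower, and every automorphism tower of $G$ terminates. -/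

import Mathlib

universe u

/-- A commuting system of groups `G_α` and homomorphisms `π_{α,β} : G_α → G_β` for `α ≤ β`,
indexed by the ordinals (`π_{α,α}` is the identity). -/
structure OrdinalGroupSystem where
  /-- The group `G_α`. -/
  obj : Ordinal.{u} → Type u
  /-- The group structure of `G_α`. -/
  group : ∀ α, Group (obj α)
  /-- The homomorphism `π_{α,β}`. -/
  map : ∀ α β, α ≤ β → obj α →* obj β
  map_self : ∀ α (g : obj α), map α α le_rfl g = g
  map_map : ∀ α β γ (h : α ≤ β) (h' : β ≤ γ) (g : obj α),
    map β γ h' (map α β h g) = map α γ (h.trans h') g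

namespace OrdinalGroupSystem

instance instGroupObj (S : OrdinalGroupSystem.{u}) (α : Ordinal.{u}) : Group (S.obj α) :=
  S.group α

instance instDirectedSystem (S : OrdinalGroupSystem.{u}) (l : Ordinal.{u}) :
    DirectedSystem (fun α : Set.Iio l => S.obj α)
      (fun α β (h : α ≤ β) => S.map (α : Ordinal.{u}) (β : Ordinal.{u}) h) where
  map_self _ g := S.map_self _ g
  map_map _ _ _ hij hjk g := S.map_map _ _ _ hij hjk g

/-- The direct limit of the groups `G_α`, `α < l`, along the maps `π_{α,β}`. -/
abbrev LimitBelow (S : OrdinalGroupSystem.{u}) (l : Ordinal.{u}) : Type (u + 1) :=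
  DirectLimit (fun α : Set.Iio l => S.obj α)
    (fun α β (h : α ≤ β) => S.map (α : Ordinal.{u}) (β : Ordinal.{u}) h)

/-- The canonical homomorphism from the direct limit of the `G_α`, `α < l`, to `G_l`: it sends
the class of `g ∈ G_α` to `π_{α,l}(g)`. For a limit ordinal `l` the index set is nonempty, which
is what makes `LimitBelow` a group. -/
def limitComparison (S : OrdinalGroupSystem.{u}) (l : Ordinal.{u}) [Nonempty (Set.Iio l)] :
    S.LimitBelow l →* S.obj l where
  toFun := DirectLimit.lift _ (fun (α : Set.Iio l) (g : S.obj α) => S.map α l α.2.le g)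
    (fun α β h g => (S.map_map α β l h β.2.le g).symm)
  map_one' := DirectLimit.lift_one (fun α : Set.Iio l => S.map α l α.2.le)
    (fun α β h g => (S.map_map α β l h β.2.le g).symm)
  map_mul' := DirectLimit.lift_mul (fun α : Set.Iio l => S.map α l α.2.le)
    (fun α β h g => (S.map_map α β l h β.2.le g).symm)

end OrdinalGroupSystem

/-- An automorphism tower of `G`:  `G_0 = G`;  `G_{α+1} = Aut(G_α)`, with `π_{α,α+1}` the natural
map sending `g` to the inner automorphism `h ↦ g * h * g⁻¹`;  and `G_l` is the direct limit of
the `G_α`, `α < l`, when `l` is a limit ordinal.  The three clauses are required up to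
isomorphism, so that this determines the tower up to a unique isomorphism. -/
structure AutomorphismTower (G : Type u) [Group G] extends OrdinalGroupSystem.{u} where
  zeroEquiv : obj 0 ≃* G
  succEquiv : ∀ α, obj (Order.succ α) ≃* MulAut (obj α)
  succEquiv_map : ∀ α (g : obj α),
    succEquiv α (map α (Order.succ α) (Order.le_succ α) g) = MulAut.conj g
  limit_bijective : ∀ (l : Ordinal.{u}) (hl : Order.IsSuccLimit l),
    haveI : Nonempty (Set.Iio l) := hl.nonempty_Iio.to_subtype
    Function.Bijective (toOrdinalGroupSystem.limitComparison l)

/-! Every group has an automorphism tower. The transfinite iteration of `X ↦ Aut(X)` is carried out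
one universe higher, where the colimits of all initial segments of the ordinals exist, and its
terms are then replaced by isomorphic groups in the universe of `G`. -/

namespace AutomorphismTower

section Existence

open CategoryTheory Limits SmallObject

variable (G : Type u) [Group G]

/-- The step `X → Aut(X)` of the iteration, given by the natural map, with initial group `G`. -/
def succStruct : SuccStruct GrpCat.{u+1} where
  X₀ := GrpCat.of (ULift.{u+1} G)
  succ X := GrpCat.of (MulAut X)
  toSucc _ := GrpCat.ofHom MulAut.conj

theorem hasIterationOfShape : HasIterationOfShape Ordinal.{u} GrpCat.{u+1} where
  hasColimitsOfShape_of_isSuccLimit j hj := by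
    have : Nonempty (Set.Iio j) := hj.nonempty_Iio.to_subtype
    exact ⟨fun F => ⟨⟨_, GrpCat.FilteredColimits.colimitCoconeIsColimit.{u+1,u+1} F⟩⟩⟩
  hasColimitsOfShape :=
    ⟨fun F => ⟨⟨_, GrpCat.FilteredColimits.colimitCoconeIsColimit.{u+1,u+1} F⟩⟩⟩

attribute [local instance] hasIterationOfShape

/-- The iteration of `X ↦ Aut(X)`. -/
noncomputable abbrev iter : Ordinal.{u} ⥤ GrpCat.{u+1} := (succStruct G).iterationFunctor Ordinal.{u}

noncomputable def iterBotEquiv : (iter G).obj ⊥ ≃* G :=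
  (((succStruct G).iterationFunctorObjBotIso Ordinal.{u}).groupIsoToMulEquiv).trans MulEquiv.ulift

noncomputable def iterSuccEquiv (α : Ordinal.{u}) : (iter G).obj (Order.succ α) ≃* MulAut ((iter G).obj α) :=
  ((succStruct G).iterationFunctorObjSuccIso α (not_isMax α)).groupIsoToMulEquiv

theorem iterSuccEquiv_map (α : Ordinal.{u}) (g : (iter G).obj α) :
    iterSuccEquiv G α ((iter G).map (homOfLE (Order.le_succ α)) g) = MulAut.conj g := by
  have := (succStruct G).iterationFunctor_map_succ α (not_isMax α)
  have h2 : (iter G).map (homOfLE (Order.le_succ α)) ≫ ((succStruct G).iterationFunctorObjSuccIso α (not_isMax α)).hom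
    = (succStruct G).toSucc _ := by
    rw [this]; simp
  exact ConcreteCategory.congr_hom h2 g

theorem iter_limit_surj (l : Ordinal.{u}) (hl : Order.IsSuccLimit l) (x : (iter G).obj l) :
    ∃ (α : Ordinal.{u}) (h : α < l) (g : (iter G).obj α), (iter G).map (homOfLE h.le) g = x := by
  have hc := (iter G).isColimitOfIsWellOrderContinuous l hl
  have : Nonempty (Set.Iio l) := hl.nonempty_Iio.to_subtype
  obtain ⟨j, y, hy⟩ := Types.jointly_surjective _ (isColimitOfPreserves (forget GrpCat.{u+1}) hc) x
  exact ⟨j.1, j.2, y, hy⟩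

theorem iter_limit_eq (l : Ordinal.{u}) (hl : Order.IsSuccLimit l) (α : Ordinal.{u}) (h : α < l)
    (x y : (iter G).obj α) (hxy : (iter G).map (homOfLE h.le) x = (iter G).map (homOfLE h.le) y) :
    ∃ (β : Ordinal.{u}) (h : α ≤ β), β < l ∧ (iter G).map (homOfLE h) x = (iter G).map (homOfLE h) y := by
  have hc := (iter G).isColimitOfIsWellOrderContinuous l hl
  have : Nonempty (Set.Iio l) := hl.nonempty_Iio.to_subtype
  obtain ⟨k, f, hf⟩ := (Types.FilteredColimit.isColimit_eq_iff' (isColimitOfPreserves (forget GrpCat.{u+1}) hc) (i := (⟨α, h⟩ : Set.Iio l)) x y).1 hxy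
  exact ⟨k.1, leOfHom f, k.2, hf⟩

theorem small_iter (α : Ordinal.{u}) : Small.{u} ((iter G).obj α) := by
  induction α using SuccOrder.limitRecOn with
  | isMin a h =>
    obtain rfl := h.eq_bot
    exact small_map (iterBotEquiv G).toEquiv
  | succ a _ ih =>
    have : Small.{u} (MulAut ((iter G).obj a)) := 
      small_of_injective (β := (iter G).obj a → (iter G).obj a) (f := fun e => e) DFunLike.coe_injective
    exact small_map (iterSuccEquiv G a).toEquiv
  | isSuccLimit a ha ih =>
    have : ∀ b : Set.Iio a, Small.{u} ((iter G).obj b) := fun b => ih b b.2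
    refine small_of_surjective (α := Σ b : Set.Iio a, (iter G).obj b)
      (f := fun p => (iter G).map (homOfLE p.1.2.le) p.2) ?_
    intro x
    obtain ⟨α, h, g, hg⟩ := iter_limit_surj G a ha x
    exact ⟨⟨⟨α, h⟩, g⟩, hg⟩

attribute [local instance] small_iter

noncomputable def shrinkIter (α : Ordinal.{u}) : Shrink.{u} ((iter G).obj α) ≃* (iter G).obj α := Shrink.mulEquiv

noncomputable def system : OrdinalGroupSystem.{u} where
  obj α := Shrink.{u} ((iter G).obj α)
  group α := inferInstance
  map α β h := ((shrinkIter G β).symm.toMonoidHom.comp ((iter G).map (homOfLE h)).hom).comp (shrinkIter G α).toMonoidHom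
  map_self α g := by
    simp
  map_map α β γ h h' g := by
    have : (iter G).map (homOfLE (h.trans h')) = (iter G).map (homOfLE h) ≫ (iter G).map (homOfLE h') := by
      rw [← (iter G).map_comp]; rfl
    simp [this]

theorem system_map (α β : Ordinal.{u}) (h : α ≤ β) (g) :
    (system G).map α β h g = (shrinkIter G β).symm ((iter G).map (homOfLE h) (shrinkIter G α g)) := rfl

/-- The automorphism tower of `G`, built by transfinite iteration. -/
noncomputable def ofGroup : AutomorphismTower G where
  toOrdinalGroupSystem := system G
  zeroEquiv := (shrinkIter G 0).trans (iterBotEquiv G)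
  succEquiv α := ((shrinkIter G _).trans (iterSuccEquiv G α)).trans (MulAut.congr (shrinkIter G α).symm)
  succEquiv_map α g := by
    have h : shrinkIter G (Order.succ α) ((system G).map α (Order.succ α) (Order.le_succ α) g)
      = (iter G).map (homOfLE (Order.le_succ α)) (shrinkIter G α g) := by
        rw [system_map]; simp
    change MulAut.congr (shrinkIter G α).symm (iterSuccEquiv G α (shrinkIter G (Order.succ α)
      ((system G).map α (Order.succ α) (Order.le_succ α) g))) = _
    rw [h, iterSuccEquiv_map]
    have key : ∀ a b : Shrink.{u} ((iter G).obj α),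
        (shrinkIter G α).symm ((shrinkIter G α a) * (shrinkIter G α b) * (shrinkIter G α a)⁻¹) = a * b * a⁻¹ := fun a b => by
      simp only [map_mul, map_inv, MulEquiv.symm_apply_apply]
    exact MulEquiv.ext fun x => key g x
  limit_bijective l hl := by
    have : Nonempty (Set.Iio l) := hl.nonempty_Iio.to_subtype
    constructor
    · intro x y
      refine DirectLimit.induction₂ _ (C := fun x y => (system G).limitComparison l x = (system G).limitComparison l y → x = y) ?_ x y
      rintro ⟨i, hi⟩ a b hab
      have hab' : (shrinkIter G l).symm ((iter G).map (homOfLE (le_of_lt hi)) (shrinkIter G i a)) =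
        (shrinkIter G l).symm ((iter G).map (homOfLE (le_of_lt hi)) (shrinkIter G i b)) := hab
      obtain ⟨k, h, hk, hh⟩ := iter_limit_eq G l hl i hi _ _ ((shrinkIter G l).symm.injective hab')
      refine Quotient.sound ⟨⟨k, hk⟩, h, h, ?_⟩
      exact congrArg (shrinkIter G k).symm hh
    · intro x
      obtain ⟨α, h, g, hg⟩ := iter_limit_surj G l hl (shrinkIter G l x)
      refine ⟨Quotient.mk _ ⟨⟨α, h⟩, (shrinkIter G α).symm g⟩, ?_⟩
      change (shrinkIter G l).symm ((iter G).map (homOfLE h.le) (shrinkIter G α ((shrinkIter G α).symm g))) = x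
      rw [MulEquiv.apply_symm_apply, hg]
      exact (shrinkIter G l).symm_apply_apply x

end Existence

end AutomorphismTower

/-- The tower terminates: some `G_γ` is isomorphic to `Aut(G_γ)` by the natural map. -/
def AutomorphismTower.Terminates {G : Type u} [Group G] (T : AutomorphismTower G) : Prop :=
  ∃ γ : Ordinal.{u}, Function.Bijective (MulAut.conj : T.obj γ →* MulAut (T.obj γ))

/-! Each stage is a set, so its elements that ever die do so by a bounded stage. At a limit `γ`
closed under this bound, a central element dies at the next stage, hence is already trivial
(`exists_center_eq_bot`). From `γ` on, the image of `G_γ` has trivial centralizer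
(`eq_one_of_forall_commute`), so an element is determined by how it conjugates that image.

If no stage is terminal, every `α ≥ γ` has an outer `h ∈ G_{α+1}`. When the cofinality of `α`
exceeds `|G_γ|`, `h` conjugates `G_γ` into some `G_β` with `β < α`. For fixed `β`, the resulting map
`G_γ → G_β` determines `α`, so such `α` are bounded in terms of `β`. A limit `α` closed under these
bounds gives a contradiction. -/

theorem Ordinal.exists_isSuccLimit_closed (k : Ordinal.{u} → Ordinal.{u}) (γ : Ordinal.{u})
    (ι : Type u) : ∃ α : Ordinal.{u}, Order.IsSuccLimit α ∧ γ < α ∧ (∀ β < α, k β < α) ∧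
      ∀ f : ι → Ordinal.{u}, (∀ x, f x < α) → ∃ δ < α, ∀ x, f x < δ := by
  -- A majorant of `k` on whole initial segments: a bound at stages cofinal in the limit then
  -- suffices.
  let k' : Ordinal.{u} → Ordinal.{u} := fun β => max (max γ β) (⨆ b : Set.Iic β, k b)
  have hk' : ∀ {b β}, b ≤ β → k b ≤ k' β := fun {b β} h =>
    (Ordinal.le_iSup (fun b : Set.Iic β => k b) ⟨b, h⟩).trans (le_max_right _ _)
  let e : Ordinal.{u} → Ordinal.{u} := WellFoundedLT.fix
    (motive := fun _ => Ordinal.{u}) (fun i r => ⨆ j : Set.Iio i, Order.succ (k' (r j j.2)))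
  have he : ∀ i, e i = ⨆ j : Set.Iio i, Order.succ (k' (e j)) := fun i =>
    WellFoundedLT.fix_eq (motive := fun _ => Ordinal.{u}) _ i
  have hlt : ∀ {i j}, i < j → k' (e i) < e j := fun {i j} h => by
    rw [he j]
    exact (Order.lt_succ _).trans_le
      (Ordinal.le_iSup (fun j' : Set.Iio j => Order.succ (k' (e j'))) ⟨i, h⟩)
  have hself : ∀ β, β ≤ k' β := fun β => (le_max_right _ _).trans (le_max_left _ _)
  have hmono : StrictMono e := fun i j h => (hself _).trans_lt (hlt h)
  -- A successor cardinal is regular, and this one exceeds `|ι|`, so `ι`-indexed families below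
  -- `c.ord` are bounded.
  let c : Cardinal.{u} := Order.succ (max Cardinal.aleph0 (Cardinal.mk ι))
  have hc : c.IsRegular := Cardinal.isRegular_succ (le_max_left _ _)
  have hl : Order.IsSuccLimit c.ord := Cardinal.isSuccLimit_ord hc.aleph0_le
  have hex : ∀ β < e c.ord, ∃ j < c.ord, β < e j := fun β h => by
    rw [he c.ord, Ordinal.lt_iSup_iff] at h
    obtain ⟨⟨j, hj⟩, h⟩ := h
    exact ⟨Order.succ j, hl.succ_lt hj, (Order.lt_succ_iff.1 h).trans_lt (hlt (Order.lt_succ j))⟩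
  have hpos : γ < e c.ord :=
    ((le_max_left _ _).trans (le_max_left _ _)).trans_lt (hlt hl.bot_lt)
  refine ⟨e c.ord, ?_, hpos, ?_, ?_⟩
  · refine Order.isSuccLimit_iff_of_orderBot.2 ⟨hpos.ne_bot, ?_⟩
    refine Order.isSuccPrelimit_of_succ_lt fun β h => ?_
    obtain ⟨j, hj, h⟩ := hex β h
    exact (Order.succ_le_of_lt h).trans_lt (hmono hj)
  · intro β h
    obtain ⟨j, hj, h⟩ := hex β h
    exact (hk' h.le).trans_lt (hlt hj)
  · intro f hf
    choose j hj hfj using fun x => hex (f x) (hf x)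
    have hsup : ⨆ x, j x < c.ord := by
      refine Ordinal.iSup_lt_of_lt_cof ?_ hj
      rw [hc.cof_ord]
      exact (le_max_right _ _).trans_lt (Order.lt_succ _)
    exact ⟨_, hmono hsup, fun x =>
      (hfj x).trans_le (hmono.monotone (Ordinal.le_iSup j x))⟩

namespace AutomorphismTower

variable {G : Type u} [Group G] (T : AutomorphismTower G)

/-! ### Successor and limit stages. -/

/-- This is the identity `φ ∘ conj g ∘ φ⁻¹ = conj (φ g)` in `Aut(G_α)`. -/
theorem mul_map_mul_inv (α : Ordinal.{u}) (x : T.obj (Order.succ α)) (g : T.obj α) :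
    x * T.map α _ (Order.le_succ α) g * x⁻¹ =
      T.map α _ (Order.le_succ α) (T.succEquiv α x g) := by
  apply (T.succEquiv α).injective
  rw [map_mul, map_mul, map_inv, T.succEquiv_map, T.succEquiv_map]
  ext y
  simp [MulAut.conj_apply]

theorem map_succ_injective {α : Ordinal.{u}} (h : Subgroup.center (T.obj α) = ⊥) :
    Function.Injective (T.map α _ (Order.le_succ α)) := by
  refine (injective_iff_map_eq_one _).2 fun g hg => ?_
  have hconj : MulAut.conj g = 1 := by rw [← T.succEquiv_map, hg, map_one]
  have : g ∈ Subgroup.center (T.obj α) := Subgroup.mem_center_iff.2 fun y =>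
    (mul_inv_eq_iff_eq_mul.1 (DFunLike.congr_fun hconj y)).symm
  rwa [h, Subgroup.mem_bot] at this

theorem map_succ_eq_one {α : Ordinal.{u}} {g : T.obj α}
    (h : g ∈ Subgroup.center (T.obj α)) : T.map α _ (Order.le_succ α) g = 1 := by
  apply (T.succEquiv α).injective
  rw [T.succEquiv_map, map_one]
  ext y
  rw [MulAut.conj_apply, ← Subgroup.mem_center_iff.1 h y, mul_inv_cancel_right]
  rfl

theorem exists_map_eq {l : Ordinal.{u}} (hl : Order.IsSuccLimit l) (x : T.obj l) :
    ∃ (α : Ordinal.{u}) (h : α < l) (g : T.obj α), T.map α l h.le g = x := by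
  have : Nonempty (Set.Iio l) := hl.nonempty_Iio.to_subtype
  obtain ⟨y, rfl⟩ := (T.limit_bijective l hl).2 x
  obtain ⟨⟨⟨α, h⟩, g⟩, rfl⟩ := Quotient.exists_rep y
  exact ⟨α, h, g, rfl⟩

theorem exists_le_map_eq {l : Ordinal.{u}} (hl : Order.IsSuccLimit l) {γ : Ordinal.{u}}
    (hγ : γ < l) (x : T.obj l) :
    ∃ (α : Ordinal.{u}) (_ : γ ≤ α) (h : α < l) (g : T.obj α), T.map α l h.le g = x := by
  obtain ⟨α, h, g, rfl⟩ := T.exists_map_eq hl x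
  exact ⟨max γ α, le_max_left _ _, max_lt hγ h, T.map _ _ (le_max_right _ _) g, T.map_map ..⟩

theorem exists_map_eq_one {l : Ordinal.{u}} (hl : Order.IsSuccLimit l) {α : Ordinal.{u}}
    (h : α < l) {g : T.obj α} (hg : T.map α l h.le g = 1) :
    ∃ (β : Ordinal.{u}) (h : α ≤ β), β < l ∧ T.map α β h g = 1 := by
  have : Nonempty (Set.Iio l) := hl.nonempty_Iio.to_subtype
  have hmk : (Quotient.mk _ ⟨⟨α, h⟩, g⟩ : T.LimitBelow l) = Quotient.mk _ ⟨⟨α, h⟩, 1⟩ :=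
    (T.limit_bijective l hl).1 (hg.trans (map_one (T.map α l h.le)).symm)
  obtain ⟨⟨β, hβ⟩, h₁, h₂, he⟩ := Quotient.exact hmk
  exact ⟨β, h₁, hβ, he.trans (map_one (T.map α β h₁))⟩

theorem map_injective_of_center_eq_bot {α β : Ordinal.{u}} (h : α ≤ β)
    (hz : ∀ δ, α ≤ δ → δ < β → Subgroup.center (T.obj δ) = ⊥) :
    Function.Injective (T.map α β h) := by
  induction β using SuccOrder.limitRecOn with
  | isMin b hb =>
    obtain rfl : α = b := le_antisymm h (hb h)
    intro x y hxy
    rwa [T.map_self, T.map_self] at hxy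
  | succ b _ ih =>
    obtain rfl | hlt := h.eq_or_lt
    · intro x y hxy
      rwa [T.map_self, T.map_self] at hxy
    · have hab := Order.lt_succ_iff.1 hlt
      intro x y hxy
      rw [← T.map_map _ _ _ hab (Order.le_succ b), ← T.map_map _ _ _ hab (Order.le_succ b)] at hxy
      exact ih hab (fun δ h₁ h₂ => hz δ h₁ (h₂.trans (Order.lt_succ b)))
        (T.map_succ_injective (hz b hab (Order.lt_succ b)) hxy)
  | isSuccLimit b hb ih =>
    obtain rfl | hlt := h.eq_or_lt
    · intro x y hxy
      rwa [T.map_self, T.map_self] at hxy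
    · refine (injective_iff_map_eq_one _).2 fun g hg => ?_
      obtain ⟨c, hac, hcb, hc⟩ := T.exists_map_eq_one hb hlt hg
      exact (injective_iff_map_eq_one _).1
        (ih c hcb hac fun δ h₁ h₂ => hz δ h₁ (h₂.trans hcb)) g hc

/-- Some group in the tower has trivial center: at a limit stage closed under the bound for the
stages by which the elements that ever become trivial have done so, the maps are injective. -/
theorem exists_center_eq_bot : ∃ γ, Subgroup.center (T.obj γ) = ⊥ := by
  have hdie : ∀ α, ∃ β : Ordinal.{u}, ∃ h : α ≤ β, ∀ (g : T.obj α) (δ : Ordinal.{u}) (hδ : α ≤ δ),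
      T.map α δ hδ g = 1 → T.map α β h g = 1 := by
    intro α
    have : ∀ g : T.obj α, ∃ b : Ordinal.{u}, ∃ h : α ≤ b, ∀ (δ : Ordinal.{u}) (hδ : α ≤ δ),
        T.map α δ hδ g = 1 → T.map α b h g = 1 := fun g => by
      by_cases hg : ∃ (δ : Ordinal.{u}) (hδ : α ≤ δ), T.map α δ hδ g = 1
      · obtain ⟨δ, hδ, he⟩ := hg
        exact ⟨δ, hδ, fun _ _ _ => he⟩
      · exact ⟨α, le_rfl, fun δ hδ he => (hg ⟨δ, hδ, he⟩).elim⟩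
    choose b hb hb' using this
    -- The identity element serves only to show that the supremum is at least `α`.
    refine ⟨⨆ g, b g, (hb 1).trans (Ordinal.le_iSup b 1), fun g δ hδ he => ?_⟩
    rw [← T.map_map _ _ _ (hb g) (Ordinal.le_iSup b g), hb' g δ hδ he, map_one]
  choose k hk hk' using hdie
  -- Only closure under `k` matters here; `0` and `PUnit` are placeholders.
  obtain ⟨γ, hγ, -, hcl, -⟩ := Ordinal.exists_isSuccLimit_closed k 0 PUnit
  refine ⟨γ, (Subgroup.eq_bot_iff_forall _).2 fun x hx => ?_⟩
  obtain ⟨α, hα, g, rfl⟩ := T.exists_map_eq hγ x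
  have h1 := T.map_succ_eq_one hx
  rw [T.map_map] at h1
  rw [← T.map_map _ _ _ (hk α) (hcl α hα).le, hk' α g _ _ h1, map_one]

/-! ### Centralizers of the image of a centerless stage. -/

/-- An automorphism of `G_β` that fixes the image of `G_γ` pointwise is trivial, if the image of
`G_γ` has trivial centralizer in `G_β`. -/
theorem apply_map_eq {γ β : Ordinal.{u}} (hγβ : γ ≤ β)
    (hc : ∀ x : T.obj β, (∀ g, Commute x (T.map γ β hγβ g)) → x = 1)
    (φ : MulAut (T.obj β)) (hφ : ∀ g, φ (T.map γ β hγβ g) = T.map γ β hγβ g)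
    {δ : Ordinal.{u}} (hγδ : γ ≤ δ) (hδβ : δ ≤ β) (x : T.obj δ) :
    φ (T.map δ β hδβ x) = T.map δ β hδβ x := by
  induction δ using SuccOrder.limitRecOn with
  | isMin b hb =>
    obtain rfl : γ = b := le_antisymm hγδ (hb hγδ)
    exact hφ x
  | succ b _ ih =>
    obtain rfl | hlt := hγδ.eq_or_lt
    · exact hφ x
    have hγb := Order.lt_succ_iff.1 hlt
    have hbβ := (Order.le_succ b).trans hδβ
    have hconj : ∀ y : T.obj b, T.map _ β hδβ x * T.map b β hbβ y * (T.map _ β hδβ x)⁻¹ =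
        T.map b β hbβ (T.succEquiv b x y) := fun y => by
      rw [← T.map_map b _ β (Order.le_succ b) hδβ, ← T.map_map b _ β (Order.le_succ b) hδβ,
        ← T.mul_map_mul_inv, map_mul, map_mul, map_inv]
    have hconj' : ∀ y : T.obj b, φ (T.map _ β hδβ x) * T.map b β hbβ y *
        (φ (T.map _ β hδβ x))⁻¹ = T.map _ β hδβ x * T.map b β hbβ y * (T.map _ β hδβ x)⁻¹ :=
      fun y => by
        have := congrArg φ (hconj y)
        rw [map_mul, map_mul, map_inv, ih hγb hbβ, ih hγb hbβ] at this
        rw [this, hconj]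
    -- Since `φ` fixes the image of `G_b`, the elements `x` and `φ x` conjugate it alike, so `x⁻¹ *
    -- φ x` centralizes the image of `G_γ`.
    have := hc ((T.map _ β hδβ x)⁻¹ * φ (T.map _ β hδβ x)) fun g => by
      have h := hconj' (T.map γ b hγb g)
      rw [T.map_map] at h
      rw [commute_iff_eq, mul_assoc, mul_inv_eq_iff_eq_mul.1 h]
      group
    exact (inv_mul_eq_one.1 this).symm
  | isSuccLimit b hb ih =>
    obtain rfl | hlt := hγδ.eq_or_lt
    · exact hφ x
    obtain ⟨c, hγc, hcb, y, rfl⟩ := T.exists_le_map_eq hb hlt x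
    rw [T.map_map]
    exact ih c hcb hγc (hcb.le.trans hδβ) y

/-- Induction on `β`. At a successor, `x` is an automorphism of `G_b` fixing the image of `G_γ`, so
`apply_map_eq` makes it trivial. At a limit, `x` comes from an earlier stage, whose map to the limit
is injective because the intermediate centers are trivial. -/
theorem eq_one_of_forall_commute {γ : Ordinal.{u}} (hz : Subgroup.center (T.obj γ) = ⊥)
    {β : Ordinal.{u}} (h : γ ≤ β) (x : T.obj β) (hx : ∀ g, Commute x (T.map γ β h g)) :
    x = 1 := by
  have hbase : ∀ x : T.obj γ, (∀ g, Commute x (T.map γ γ le_rfl g)) → x = 1 := fun x hx => by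
    rw [← Subgroup.mem_bot, ← hz, Subgroup.mem_center_iff]
    intro g
    have := hx g
    rw [T.map_self] at this
    exact this.symm
  have hcenter : ∀ δ (h : γ ≤ δ),
      (∀ x : T.obj δ, (∀ g, Commute x (T.map γ δ h g)) → x = 1) →
      Subgroup.center (T.obj δ) = ⊥ := fun δ h hδ =>
    (Subgroup.eq_bot_iff_forall _).2 fun x hx =>
      hδ x fun g => (Subgroup.mem_center_iff.1 hx _).symm
  induction β using SuccOrder.limitRecOn with
  | isMin b hb =>
    obtain rfl : γ = b := le_antisymm h (hb h)
    exact hbase x hx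
  | succ b _ ih =>
    obtain rfl | hlt := h.eq_or_lt
    · exact hbase x hx
    have hγb := Order.lt_succ_iff.1 hlt
    have hinj := T.map_succ_injective (hcenter b hγb (ih hγb))
    have hfix : ∀ g, T.succEquiv b x (T.map γ b hγb g) = T.map γ b hγb g := fun g => by
      apply hinj
      rw [← T.mul_map_mul_inv, T.map_map, (hx g).eq, mul_inv_cancel_right]
    apply (T.succEquiv b).injective
    rw [map_one]
    ext y
    have := T.apply_map_eq hγb (ih hγb) _ hfix hγb le_rfl y
    rwa [T.map_self] at this
  | isSuccLimit b hb ih =>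
    obtain rfl | hlt := h.eq_or_lt
    · exact hbase x hx
    obtain ⟨c, hγc, hcb, y, rfl⟩ := T.exists_le_map_eq hb hlt x
    have hinj : Function.Injective (T.map c b hcb.le) :=
      T.map_injective_of_center_eq_bot _ fun δ h₁ h₂ =>
        hcenter δ (hγc.trans h₁) (ih δ h₂ (hγc.trans h₁))
    rw [ih c hcb hγc y fun g => hinj ?_, map_one]
    have := (hx g).eq
    rwa [← T.map_map _ _ _ hγc hcb.le, ← map_mul, ← map_mul] at this

theorem center_eq_bot_of_le {γ : Ordinal.{u}} (hz : Subgroup.center (T.obj γ) = ⊥)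
    {β : Ordinal.{u}} (h : γ ≤ β) : Subgroup.center (T.obj β) = ⊥ :=
  (Subgroup.eq_bot_iff_forall _).2 fun x hx =>
    T.eq_one_of_forall_commute hz h x fun _ => (Subgroup.mem_center_iff.1 hx _).symm

/-- Over a centerless `G_γ`, an element is determined by the conjugation it induces on the image
of `G_γ`. -/
theorem eq_of_conj_eq {γ : Ordinal.{u}} (hz : Subgroup.center (T.obj γ) = ⊥)
    {β : Ordinal.{u}} (h : γ ≤ β) {x y : T.obj β}
    (hxy : ∀ g, x * T.map γ β h g * x⁻¹ = y * T.map γ β h g * y⁻¹) : x = y := by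
  refine (inv_mul_eq_one.1 (T.eq_one_of_forall_commute hz h (y⁻¹ * x) fun g => ?_)).symm
  rw [commute_iff_eq, mul_assoc, mul_inv_eq_iff_eq_mul.1 (hxy g)]
  group

theorem conj_injective {α : Ordinal.{u}} (hz : Subgroup.center (T.obj α) = ⊥) :
    Function.Injective (MulAut.conj : T.obj α →* MulAut (T.obj α)) := fun x y hxy =>
  T.map_succ_injective hz ((T.succEquiv α).injective (by
    rw [T.succEquiv_map, T.succEquiv_map, hxy]))

/-! ### Outer elements and termination. -/

/-- The element `h` of `G_{α+1}` conjugates `G_γ` into `G_β`, inducing the map `y`. -/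
def ConjugatesVia {γ β α : Ordinal.{u}} (hγ : γ ≤ α) (hβ : β ≤ α) (y : T.obj γ → T.obj β)
    (h : T.obj (Order.succ α)) : Prop :=
  ∀ g, h * T.map γ _ (hγ.trans (Order.le_succ α)) g * h⁻¹ =
    T.map β _ (hβ.trans (Order.le_succ α)) (y g)

/-- Since `α + 1 ≤ α'`, the image of `h` in `G_{α'+1}` factors through `G_{α'}`; it acts on `G_γ` as
`h'` does, so the two coincide. -/
theorem ConjugatesVia.mem_range {γ : Ordinal.{u}} (hz : Subgroup.center (T.obj γ) = ⊥)
    {β α α' : Ordinal.{u}} {hγ : γ ≤ α} {hβ : β ≤ α} {hγ' : γ ≤ α'} {hβ' : β ≤ α'}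
    {y : T.obj γ → T.obj β} {h : T.obj (Order.succ α)} {h' : T.obj (Order.succ α')}
    (hc : T.ConjugatesVia hγ hβ y h) (hc' : T.ConjugatesVia hγ' hβ' y h') (hlt : α < α') :
    h' ∈ Set.range (T.map α' _ (Order.le_succ α')) := by
  have hs : Order.succ α ≤ α' := Order.succ_le_of_lt hlt
  refine ⟨T.map _ _ hs h, ?_⟩
  rw [T.map_map]
  refine T.eq_of_conj_eq hz (hγ'.trans (Order.le_succ α')) fun g => ?_
  rw [hc' g, ← T.map_map _ _ _ (hγ.trans (Order.le_succ α)) (hs.trans (Order.le_succ α')),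
    ← map_inv, ← map_mul, ← map_mul, hc g, T.map_map]

/-- Each conjugate of an element of `G_γ` lies in `G_α`, hence appears before the limit `α`; `hcof`
gives one stage for all of them. -/
theorem exists_conjugatesVia {γ α : Ordinal.{u}} (hα : Order.IsSuccLimit α) (hγ : γ < α)
    (hcof : ∀ f : T.obj γ → Ordinal.{u}, (∀ x, f x < α) → ∃ δ < α, ∀ x, f x < δ)
    (h : T.obj (Order.succ α)) :
    ∃ (β : Ordinal.{u}) (hβ : β < α) (y : T.obj γ → T.obj β), T.ConjugatesVia hγ.le hβ.le y h := by
  choose b hb z hbz using fun g : T.obj γ =>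
    T.exists_map_eq hα (T.succEquiv α h (T.map γ α hγ.le g))
  obtain ⟨δ, hδ, hbδ⟩ := hcof b hb
  refine ⟨δ, hδ, fun g => T.map _ _ (hbδ g).le (z g), fun g => ?_⟩
  rw [T.map_map, ← T.map_map _ _ _ hγ.le (Order.le_succ α), T.mul_map_mul_inv, ← hbz, T.map_map]

theorem terminates : T.Terminates := by
  obtain ⟨γ, hz⟩ := T.exists_center_eq_bot
  by_contra hT
  have hout : ∀ α, γ ≤ α → ∃ h, h ∉ Set.range (T.map α _ (Order.le_succ α)) := by
    intro α hα
    by_contra! hall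
    refine hT ⟨α, T.conj_injective (T.center_eq_bot_of_le hz hα), fun φ => ?_⟩
    obtain ⟨g, hg⟩ := hall ((T.succEquiv α).symm φ)
    exact ⟨g, by rw [← T.succEquiv_map, hg, MulEquiv.apply_symm_apply]⟩
  let S : Ordinal.{u} → Set Ordinal.{u} := fun β => {α | ∃ (hγ : γ ≤ α) (hβ : β ≤ α)
    (y : T.obj γ → T.obj β) (h : T.obj (Order.succ α)),
    h ∉ Set.range (T.map α _ (Order.le_succ α)) ∧ T.ConjugatesVia hγ hβ y h}
  have hS : ∀ β, BddAbove (S β) := fun β => by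
    choose hγ hβ y h hr hc using fun a : S β => a.2
    -- Equal maps at two stages would make the outer element at the later stage inner.
    have : Function.Injective y := fun a a' haa => by
      have hc' := hc a'
      rw [← haa] at hc'
      rcases lt_trichotomy a a' with hlt | heq | hgt
      · exact (hr a' ((hc a).mem_range T hz hc' hlt)).elim
      · exact heq
      · exact (hr a (hc'.mem_range T hz (hc a) hgt)).elim
    have : Small.{u} (S β) := small_of_injective this
    exact Ordinal.bddAbove_of_small
  choose k hk using hS
  obtain ⟨α, hα, hγα, hcl, hcof⟩ := Ordinal.exists_isSuccLimit_closed k γ (T.obj γ)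
  obtain ⟨h, hr⟩ := hout α hγα.le
  obtain ⟨β, hβ, y, hc⟩ := T.exists_conjugatesVia hα hγα hcof h
  exact (hcl β hβ).not_ge (hk β ⟨hγα.le, hβ.le, y, h, hr, hc⟩)

end AutomorphismTower

theorem mainTheorem1 (G : Type u) [Group G] :
    Nonempty (AutomorphismTower G) ∧ ∀ T : AutomorphismTower G, T.Terminates :=
  ⟨⟨AutomorphismTower.ofGroup G⟩, fun T => T.terminates⟩
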